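/- Let $$\mathrm{vol3}=\langle a,b \mid aab\,b\,a^{-1}b^{-1}a^{-1}bb,\ \ a\,b^{-1}a\,b^{-1}a\,b\,a\,a\,a\,b\rangle .$$ For an element $t$ of a commutative ring and a chosen square root $s=\sqrt{t^2-1}$ of $t^2-1$ in that ring, let $$\omega_t(u)=\begin{pmatrix} 1&0&0&2t&-2t&2t&0&0\\ 0&1&0&t-s&-t+s&t-s&1&0\\ 0&0&1&-1&1&-1&0&0\\ 0&0&1&0&0&0&0&0\\ 0&0&1&0&0&1&-t+s&-t-s\\ 0&0&1&-1&0&1&-t+s&-t-s\\ 0&0&0&0&0&0&0&-1\\ 0&0&0&0&0&0&1&0\end{pmatrix},\qquad \omega_t(c)=\begin{pmatrix} 0&0&1&0&0&0&0&0\\ 0&0&0&1&0&0&0&0\\ 1&0&0&0&0&0&0&0\\ 0&1&0&0&0&0&0&0\\ 0&0&0&0&0&0&-1&1\\ 0&0&0&0&0&0&-1&0\\ 0&0&0&0&0&-1&0&0\\ 0&0&0&0&1&-1&0&0\end{pmatrix},$$ and let $\omega_t$ be the representation of $\mathrm{vol3}$ in $SL(8)$ with $\omega_t(a)=\omega_t(u)^2\omega_t(c)$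 and $\omega_t(b)=(\omega_t(a)\,\omega_t(u)\,\omega_t(a))^{-1}\omega_t(u)$. For a field $K$ with an involution $\tau$ and a matrix $J=\tau(J)^{\top}\in M_m(K)$ (a $\tau$-Hermitian form), let $SU(J;K,\tau)=\{M\in SL(m,K): \tau(M)^{\top}JM=J\}$. There is a $\tau$-Hermitian matrix $J=J_t\in M_8(\mathbb{Q}(t,\sqrt{t^2-1}))$, where $t$ is transcendental and $\tau$ is the involution over $\mathbb{Q}(t)$ with $\sqrt{t^2-1}\mapsto-\sqrt{t^2-1}$, such that: 1. for every real $T\ge 1$ the coefficients in $\mathbb{Q}(t)$ of the entries of $J$ (with respect to $1,\sqrt{t^2-1}$) have no pole at $T$, and the specialized real matrix $J_T$ has full rank; moreover $\det J_t$ is a square in $\mathbb{Q}(t)$; 2. $\omega_t(\mathrm{vol3})\le SU(J_t;\mathbb{Q}(t,\sqrt{t^2-1}),\tau)$; 3. for every square-free integer $d\ge 2$, let $(t_1,y_1)$ be the fundamental solution of Pell's equation $t^2-dy^2=1$ and define $(t_n,y_n)$ by $t_n+y_n\sqrt d=(t_1+y_1\sqrt d)^n$ for $n\ge 1$. Then $t_n\to\infty$.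 Let $\mathcal{O}_d$ be the ring of integers of $\mathbb{Q}(\sqrt d)$, let $\tau$ be its involution $\sqrt d\mapsto-\sqrt d$, and let $\omega_{t_n}$ and $J_{t_n}$ be obtained by specializing $t\mapsto t_n$, $\sqrt{t^2-1}\mapsto y_n\sqrt d$. For every $n\ge1$, $$\omega_{t_n}(\mathrm{vol3})\le SU(J_{t_n};\mathcal{O}_d,\tau):=SU(J_{t_n};\mathbb{Q}(\sqrt d),\tau)\cap SL(8,\mathcal{O}_d),$$ and $SU(J_{t_n};\mathcal{O}_d,\tau)$ is commensurable to $SU(I_8;\mathcal{O}_d,\tau)$ in $SL(8,\mathbb{R})$ (embedding by $\sqrt d\mapsto\sqrt d>0$): there is $g\in SL(8,\mathbb{R})$ such that $SU(J_{t_n};\mathcal{O}_d,\tau)\cap g\,SU(I_8;\mathcal{O}_d,\tau)\,g^{-1}$ has finite index in both $SU(J_{t_n};\mathcal{O}_d,\tau)$ and $g\,SU(I_8;\mathcal{O}_d,\tau)\,g^{-1}$. -/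

import Mathlib

open Matrix Filter
open scoped Polynomial

/-! ### The group `vol3` -/

/-- The two relators `aabbABAbb` and `aBaBabaaab`, where `A = a⁻¹`, `B = b⁻¹`, in the free group on
`a = of 0` and `b = of 1`. -/
def vol3Relators : Set (FreeGroup (Fin 2)) :=
  let a : FreeGroup (Fin 2) := FreeGroup.of 0
  let b : FreeGroup (Fin 2) := FreeGroup.of 1
  {a * a * b * b * a⁻¹ * b⁻¹ * a⁻¹ * b * b,
   a * b⁻¹ * a * b⁻¹ * a * b * a * a * a * b}

/-- The fundamental group of the hyperbolic 3-manifold vol3, given by its presentation. -/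
abbrev Vol3 : Type := PresentedGroup vol3Relators

/-! ### The eight dimensional representation `ω_t`

Everything is written over a commutative ring `A` with elements `t`, `s` such that
`s * s = t * t - 1`; thus `s` plays the role of `√(t² - 1)`. -/

section Representation

variable {A : Type*} [CommRing A]

/-- The matrix `ω_t(u)`, with `s = √(t² - 1)`. -/
def omegaU (t s : A) : Matrix (Fin 8) (Fin 8) A :=
  !![1, 0, 0, 2 * t, -2 * t, 2 * t, 0, 0;
     0, 1, 0, t - s, -t + s, t - s, 1, 0;
     0, 0, 1, -1, 1, -1, 0, 0;
     0, 0, 1, 0, 0, 0, 0, 0;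
     0, 0, 1, 0, 0, 1, -t + s, -t - s;
     0, 0, 1, -1, 0, 1, -t + s, -t - s;
     0, 0, 0, 0, 0, 0, 0, -1;
     0, 0, 0, 0, 0, 0, 1, 0]

/-- The matrix `ω_t(c)`; it does not depend on `t`. -/
def omegaC : Matrix (Fin 8) (Fin 8) A :=
  !![0, 0, 1, 0, 0, 0, 0, 0;
     0, 0, 0, 1, 0, 0, 0, 0;
     1, 0, 0, 0, 0, 0, 0, 0;
     0, 1, 0, 0, 0, 0, 0, 0;
     0, 0, 0, 0, 0, 0, -1, 1;
     0, 0, 0, 0, 0, 0, -1, 0;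
     0, 0, 0, 0, 0, -1, 0, 0;
     0, 0, 0, 0, 1, -1, 0, 0]

theorem det_omegaU (t s : A) : (omegaU t s).det = 1 := by
  have h5 : (!![-1, 1, -1, 0, 0; 0, 0, 1, -t + s, -t - s; -1, 0, 1, -t + s, -t - s;
      0, 0, 0, 0, -1; 0, 0, 0, 1, 0] : Matrix (Fin 5) (Fin 5) A).det = -1 := by
    rw [Matrix.det_succ_row _ 4]
    simp [Fin.sum_univ_succ]
    rw [Matrix.det_succ_row _ 3]
    simp [Fin.sum_univ_succ, Matrix.det_fin_three, Fin.succAbove]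
    ring
  rw [omegaU, Matrix.det_succ_column_zero]
  simp [Fin.sum_univ_succ]
  rw [Matrix.det_succ_column_zero]
  simp [Fin.sum_univ_succ]
  rw [Matrix.det_succ_row _ 1]
  simp [Fin.sum_univ_succ]
  rw [neg_eq_iff_eq_neg]
  refine Eq.trans (congrArg Matrix.det ?_) h5
  ext i j; fin_cases i <;> fin_cases j <;> rfl

theorem det_omegaC : (omegaC : Matrix (Fin 8) (Fin 8) A).det = 1 := by
  have h4 : (!![0, 0, -1, 1; 0, 0, -1, 0; 0, -1, 0, 0; 1, -1, 0, 0] :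
      Matrix (Fin 4) (Fin 4) A).det = 1 := by
    rw [Matrix.det_succ_column_zero]
    simp [Fin.sum_univ_succ, Matrix.det_fin_three, Fin.succAbove]
    try ring
  have h6 : (!![1, 0, 0, 0, 0, 0; 0, 1, 0, 0, 0, 0; 0, 0, 0, 0, -1, 1; 0, 0, 0, 0, -1, 0;
      0, 0, 0, -1, 0, 0; 0, 0, 1, -1, 0, 0] : Matrix (Fin 6) (Fin 6) A).det = 1 := by
    rw [Matrix.det_succ_column_zero]
    simp [Fin.sum_univ_succ]
    rw [Matrix.det_succ_column_zero]
    simp [Fin.sum_univ_succ]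
    refine Eq.trans (congrArg Matrix.det ?_) h4
    ext i j; fin_cases i <;> fin_cases j <;> rfl
  have h7 : (!![0, 1, 0, 0, 0, 0, 0; 0, 0, 1, 0, 0, 0, 0; 1, 0, 0, 0, 0, 0, 0;
      0, 0, 0, 0, 0, -1, 1; 0, 0, 0, 0, 0, -1, 0; 0, 0, 0, 0, -1, 0, 0; 0, 0, 0, 1, -1, 0, 0] :
      Matrix (Fin 7) (Fin 7) A).det = 1 := by
    rw [Matrix.det_succ_column_zero]
    simp [Fin.sum_univ_succ]
    refine Eq.trans (congrArg Matrix.det ?_) h6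
    ext i j; fin_cases i <;> fin_cases j <;> rfl
  rw [omegaC, Matrix.det_succ_column_zero]
  simp [Fin.sum_univ_succ]
  refine Eq.trans (congrArg Matrix.det ?_) h7
  ext i j; fin_cases i <;> fin_cases j <;> rfl

/-- `ω_t(u)` as an element of `SL(8, A)`. -/
def omegaUSL (t s : A) : SpecialLinearGroup (Fin 8) A := ⟨omegaU t s, det_omegaU t s⟩

/-- `ω_t(c)` as an element of `SL(8, A)`. -/
def omegaCSL : SpecialLinearGroup (Fin 8) A := ⟨omegaC, det_omegaC⟩

/-- The image `ω_t(a)` of the generator `a = u²c`. -/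
def omegaGenA (t s : A) : SpecialLinearGroup (Fin 8) A := omegaUSL t s ^ 2 * omegaCSL

/-- The image `ω_t(b)` of the generator `b = (aua)⁻¹u`. -/
def omegaGenB (t s : A) : SpecialLinearGroup (Fin 8) A :=
  (omegaGenA t s * omegaUSL t s * omegaGenA t s)⁻¹ * omegaUSL t s

/-! The two relators are sent to `1`: this is checked on column vectors. -/

/-- The action of `SL(8, A)` on column vectors. -/
def slAct (M : SpecialLinearGroup (Fin 8) A) (x : Fin 8 → A) : Fin 8 → A :=
  (M : Matrix (Fin 8) (Fin 8) A) *ᵥ x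

theorem slAct_ext {M N : SpecialLinearGroup (Fin 8) A}
    (h : ∀ x₀ x₁ x₂ x₃ x₄ x₅ x₆ x₇ : A, slAct M ![x₀, x₁, x₂, x₃, x₄, x₅, x₆, x₇] =
      slAct N ![x₀, x₁, x₂, x₃, x₄, x₅, x₆, x₇]) : M = N := by
  refine Subtype.ext (Matrix.ext_of_mulVec_single fun i => ?_)
  have hx : ∀ x : Fin 8 → A, x = ![x 0, x 1, x 2, x 3, x 4, x 5, x 6, x 7] := by
    intro x
    funext i
    fin_cases i <;> rfl
  rw [hx (Pi.single i 1)]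
  exact h _ _ _ _ _ _ _ _

theorem slAct_mul (M N : SpecialLinearGroup (Fin 8) A) (x : Fin 8 → A) :
    slAct (M * N) x = slAct M (slAct N x) := by
  simp [slAct, ← mulVec_mulVec]

theorem slAct_one (x : Fin 8 → A) : slAct 1 x = x := by simp [slAct]

/-- The formulas are written through `w = t - s` and `v = t + s`, for which `w * v = 1`. -/
theorem slAct_u (t s x₀ x₁ x₂ x₃ x₄ x₅ x₆ x₇ w v : A) (hw : t - s = w) (hv : t + s = v) :
    slAct (omegaUSL t s) ![x₀, x₁, x₂, x₃, x₄, x₅, x₆, x₇] =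
    ![x₀ + (w + v) * (x₃ - x₄ + x₅), x₁ + w * (x₃ - x₄ + x₅) + x₆, x₂ - x₃ + x₄ - x₅, x₂,
      x₂ + x₅ - w * x₆ - v * x₇, x₂ - x₃ + x₅ - w * x₆ - v * x₇, - x₇, x₆] := by
  subst hw hv
  change omegaU t s *ᵥ _ = _
  funext i
  fin_cases i <;> simp [omegaU, mulVec, dotProduct, Fin.sum_univ_eight] <;> ring

theorem slAct_c (x₀ x₁ x₂ x₃ x₄ x₅ x₆ x₇ : A) :
    slAct omegaCSL ![x₀, x₁, x₂, x₃, x₄, x₅, x₆, x₇] =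
    ![x₂, x₃, x₀, x₁, x₇ - x₆, - x₆, - x₅, x₄ - x₅] := by
  change omegaC *ᵥ _ = _
  funext i
  fin_cases i <;> simp [omegaC, mulVec, dotProduct, Fin.sum_univ_eight] <;> ring

theorem slAct_u_sq (t s x₀ x₁ x₂ x₃ x₄ x₅ x₆ x₇ w v : A) (hw : t - s = w) (hv : t + s = v) :
    slAct (omegaUSL t s ^ 2) ![x₀, x₁, x₂, x₃, x₄, x₅, x₆, x₇] =
    ![x₀ + (w + v) * (x₂ - x₄ + x₅), x₁ + w * (x₂ - x₄ + x₅) + x₆ - x₇,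
      x₄ - x₅, x₂ - x₃ + x₄ - x₅, 2 * x₂ - 2 * x₃ + x₄ - (w + v) * x₆ - (v - w) * x₇,
      x₂ - 2 * x₃ + x₄ - (w + v) * x₆ - (v - w) * x₇, - x₆, - x₇] := by
  rw [pow_two, slAct_mul, slAct_u _ _ _ _ _ _ _ _ _ _ w v hw hv,
    slAct_u _ _ _ _ _ _ _ _ _ _ w v hw hv]
  funext i
  fin_cases i <;> simp <;> ring

theorem slAct_u_cube (t s x₀ x₁ x₂ x₃ x₄ x₅ x₆ x₇ w v : A) (hw : t - s = w) (hv : t + s = v) :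
    slAct (omegaUSL t s ^ 3) ![x₀, x₁, x₂, x₃, x₄, x₅, x₆, x₇] =
    ![x₀ + (w + v) * (x₂ - x₃), x₁ + w * (x₂ - x₃) - x₇, x₃, x₄ - x₅,
      x₂ - 2 * x₃ + 2 * x₄ - x₅ - v * x₆ + w * x₇, x₄ - x₃ - v * x₆ + w * x₇, x₇, - x₆] := by
  rw [pow_succ', slAct_mul, slAct_u_sq _ _ _ _ _ _ _ _ _ _ w v hw hv,
    slAct_u _ _ _ _ _ _ _ _ _ _ w v hw hv]
  funext i
  fin_cases i <;> simp <;> ring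

theorem omegaC_mul_self : (omegaCSL : SpecialLinearGroup (Fin 8) A) * omegaCSL = 1 := by
  refine slAct_ext fun x₀ x₁ x₂ x₃ x₄ x₅ x₆ x₇ => ?_
  rw [slAct_mul, slAct_one, slAct_c, slAct_c]
  funext i
  fin_cases i <;> simp

theorem omegaU_pow_four (t s : A) : omegaUSL t s ^ 4 = 1 := by
  refine slAct_ext fun x₀ x₁ x₂ x₃ x₄ x₅ x₆ x₇ => ?_
  rw [pow_succ', slAct_mul, slAct_u_cube _ _ _ _ _ _ _ _ _ _ _ _ rfl rfl,
    slAct_u _ _ _ _ _ _ _ _ _ _ _ _ rfl rfl, slAct_one]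
  funext i
  fin_cases i <;> simp <;> ring

theorem omegaU_inv (t s : A) : (omegaUSL t s)⁻¹ = omegaUSL t s ^ 3 := by
  rw [inv_eq_iff_mul_eq_one, ← pow_succ', omegaU_pow_four]

theorem omegaC_inv : (omegaCSL : SpecialLinearGroup (Fin 8) A)⁻¹ = omegaCSL := by
  rw [inv_eq_iff_mul_eq_one, omegaC_mul_self]

theorem omegaGenA_inv (t s : A) : (omegaGenA t s)⁻¹ = omegaCSL * omegaUSL t s ^ 2 := by
  rw [omegaGenA, _root_.mul_inv_rev, omegaC_inv, ← inv_pow, omegaU_inv, ← pow_mul,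
    show 3 * 2 = 4 + 2 from rfl, pow_add, omegaU_pow_four, one_mul]

theorem omegaGenB_eq (t s : A) :
    omegaGenB t s = omegaCSL * omegaUSL t s * omegaCSL * omegaUSL t s ^ 3 := by
  rw [omegaGenB, _root_.mul_inv_rev, _root_.mul_inv_rev, omegaGenA_inv, omegaU_inv]
  have h5 : omegaUSL t s ^ 2 * omegaUSL t s ^ 3 = omegaUSL t s := by
    rw [← pow_add, show 2 + 3 = 4 + 1 from rfl, pow_add, omegaU_pow_four, one_mul, pow_one]
  calc omegaCSL * omegaUSL t s ^ 2 * (omegaUSL t s ^ 3 * (omegaCSL * omegaUSL t s ^ 2))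
        * omegaUSL t s
      = omegaCSL * (omegaUSL t s ^ 2 * omegaUSL t s ^ 3) * omegaCSL
        * (omegaUSL t s ^ 2 * omegaUSL t s) := by simp only [mul_assoc]
    _ = _ := by rw [h5, ← pow_succ]

theorem omegaGenB_inv (t s : A) :
    (omegaGenB t s)⁻¹ = omegaUSL t s * omegaCSL * omegaUSL t s ^ 3 * omegaCSL := by
  rw [omegaGenB_eq, ← omegaU_inv]
  simp only [_root_.mul_inv_rev, omegaC_inv, inv_inv, mul_assoc]

set_option maxHeartbeats 1000000 in
theorem omega_word_one (t s : A) (h : s * s = t * t - 1) :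
    let u := omegaUSL t s
    let c : SpecialLinearGroup (Fin 8) A := omegaCSL
    u ^ 2 * (c * (u ^ 3 * (c * (u ^ 3 * (c * (u * (c * (u ^ 3 * c)))))))) =
      u * (c * (u ^ 3 * (c * (u * (c * (u ^ 3 * (c * (u ^ 3 * (c * u))))))))) := by
  intro u c
  refine slAct_ext fun x₀ x₁ x₂ x₃ x₄ x₅ x₆ x₇ => ?_
  have hwv : (t - s) * (t + s) = 1 := by linear_combination -h
  obtain ⟨w, hw⟩ : ∃ w, t - s = w := ⟨_, rfl⟩
  obtain ⟨v, hv⟩ : ∃ v, t + s = v := ⟨_, rfl⟩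
  rw [hw, hv] at hwv
  simp only [u, c, slAct_mul, slAct_u t s _ _ _ _ _ _ _ _ w v hw hv,
    slAct_u_sq t s _ _ _ _ _ _ _ _ w v hw hv, slAct_u_cube t s _ _ _ _ _ _ _ _ w v hw hv,
    slAct_c]
  clear h hw hv
  simp only [vecCons_inj, and_true]
  refine ⟨?_, ?_, ?_, ?_, ?_, ?_, ?_, ?_⟩ <;> grind

set_option maxHeartbeats 1000000 in
theorem omega_word_two (t s : A) (h : s * s = t * t - 1) :
    let u := omegaUSL t s
    let c : SpecialLinearGroup (Fin 8) A := omegaCSL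
    c * (u ^ 2 * (c * (u * (c * (u ^ 3 * (c * (u ^ 3 * (c * u ^ 3)))))))) =
      u * (c * (u ^ 3 * (c * (u ^ 3 * (c * (u * (c * (u ^ 2 * (c * u ^ 2))))))))) := by
  intro u c
  refine slAct_ext fun x₀ x₁ x₂ x₃ x₄ x₅ x₆ x₇ => ?_
  have hwv : (t - s) * (t + s) = 1 := by linear_combination -h
  obtain ⟨w, hw⟩ : ∃ w, t - s = w := ⟨_, rfl⟩
  obtain ⟨v, hv⟩ : ∃ v, t + s = v := ⟨_, rfl⟩
  rw [hw, hv] at hwv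
  simp only [u, c, slAct_mul, slAct_u t s _ _ _ _ _ _ _ _ w v hw hv,
    slAct_u_sq t s _ _ _ _ _ _ _ _ w v hw hv, slAct_u_cube t s _ _ _ _ _ _ _ _ w v hw hv,
    slAct_c]
  clear h hw hv
  simp only [vecCons_inj, and_true]
  refine ⟨?_, ?_, ?_, ?_, ?_, ?_, ?_, ?_⟩ <;> grind

theorem omega_relator_one (t s : A) (h : s * s = t * t - 1) :
    omegaGenA t s * omegaGenA t s * omegaGenB t s * omegaGenB t s * (omegaGenA t s)⁻¹ =
      (omegaGenB t s)⁻¹ * (omegaGenB t s)⁻¹ * omegaGenA t s * omegaGenB t s := by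
  have key := omega_word_one t s h
  have h4 := omegaU_pow_four t s
  have hc : (omegaCSL : SpecialLinearGroup (Fin 8) A) * omegaCSL = 1 := omegaC_mul_self
  rw [omegaGenB_inv, omegaGenA_inv, omegaGenB_eq, omegaGenA]
  generalize omegaUSL t s = u at *
  generalize (omegaCSL : SpecialLinearGroup (Fin 8) A) = c at *
  have hcc : ∀ x, c * (c * x) = x := fun x => by rw [← mul_assoc, hc, one_mul]
  have h21 : ∀ x, u ^ 2 * (u * x) = u ^ 3 * x := fun x => by rw [← mul_assoc, ← pow_succ]
  have h32 : u ^ 3 * u ^ 2 = u := by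
    rw [← pow_add, show 3 + 2 = 4 + 1 from rfl, pow_add, h4, one_mul, pow_one]
  have h12 : u * u ^ 2 = u ^ 3 := by rw [← pow_succ']
  rw [← mul_left_inj (u ^ 2)]
  simp only [mul_assoc, hcc, h21, h32] at key ⊢
  have h22 : u ^ 2 * u ^ 2 = 1 := by rw [← pow_add, h4]
  rw [h22, mul_one]
  exact key

theorem omega_relator_two (t s : A) (h : s * s = t * t - 1) :
    (omegaGenB t s)⁻¹ * omegaGenA t s * (omegaGenB t s)⁻¹ * omegaGenA t s * omegaGenB t s =
      (omegaGenA t s)⁻¹ * (omegaGenB t s)⁻¹ * (omegaGenA t s)⁻¹ * (omegaGenA t s)⁻¹ *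
        (omegaGenA t s)⁻¹ := by
  have key := omega_word_two t s h
  have h4 := omegaU_pow_four t s
  have hc : (omegaCSL : SpecialLinearGroup (Fin 8) A) * omegaCSL = 1 := omegaC_mul_self
  rw [omegaGenB_inv, omegaGenA_inv, omegaGenB_eq, omegaGenA]
  generalize omegaUSL t s = u at *
  generalize (omegaCSL : SpecialLinearGroup (Fin 8) A) = c at *
  have hcc : ∀ x, c * (c * x) = x := fun x => by rw [← mul_assoc, hc, one_mul]
  have h21 : ∀ x, u ^ 2 * (u * x) = u ^ 3 * x := fun x => by rw [← mul_assoc, ← pow_succ]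
  have h13 : ∀ x, u * (u ^ 3 * x) = x := fun x => by rw [← mul_assoc, ← pow_succ', h4, one_mul]
  have h31 : ∀ x, u ^ 3 * (u * x) = x := fun x => by rw [← mul_assoc, ← pow_succ, h4, one_mul]
  have h32 : ∀ x, u ^ 3 * (u ^ 2 * x) = u * x := fun x => by
    rw [← mul_assoc, ← pow_add, show 3 + 2 = 4 + 1 from rfl, pow_add, h4, one_mul, pow_one]
  rw [← mul_right_inj (u * c * u ^ 3)]
  simp only [mul_assoc, hcc, h21, h13, h31, h32] at key ⊢
  exact key

theorem omega_relators (t s : A) (h : s * s = t * t - 1) :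
    ∀ r ∈ vol3Relators, FreeGroup.lift ![omegaGenA t s, omegaGenB t s] r = 1 := by
  intro r hr
  rcases hr with rfl | rfl
  · have h1 := omega_relator_one t s h
    simp only [map_mul, map_inv, FreeGroup.lift_apply_of, cons_val_zero, cons_val_one]
    generalize omegaGenA t s = a at *
    generalize omegaGenB t s = b at *
    rw [h1]
    group
  · have h2 := omega_relator_two t s h
    simp only [map_mul, map_inv, FreeGroup.lift_apply_of, cons_val_zero, cons_val_one]
    generalize omegaGenA t s = a at *
    generalize omegaGenB t s = b at *
    calc a * b⁻¹ * a * b⁻¹ * a * b * a * a * a * b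
        = a * (b⁻¹ * a * b⁻¹ * a * b) * a * a * a * b := by group
      _ = 1 := by rw [h2]; group

/-- The representation `ω_t : vol3 → SL(8, A)`, with `s = √(t² - 1)`. -/
def omega (t s : A) (h : s * s = t * t - 1) : Vol3 →* SpecialLinearGroup (Fin 8) A :=
  PresentedGroup.toGroup (omega_relators t s h)

end Representation

/-! ### Special unitary groups -/

section Unitary

/-- The group `SU(J; K, τ) = {M ∈ SL(m, K) : M^* J M = J}`. The involution `τ` of `K` is `star`, and
`M^* = τ(M)ᵀ` is the conjugate transpose `Mᴴ`. -/
def SU {K : Type*} [CommRing K] [StarRing K] {m : ℕ} (J : Matrix (Fin m) (Fin m) K) :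
    Subgroup (SpecialLinearGroup (Fin m) K) where
  carrier := {M : SpecialLinearGroup (Fin m) K |
    (M : Matrix (Fin m) (Fin m) K)ᴴ * J * (M : Matrix (Fin m) (Fin m) K) = J}
  one_mem' := by simp
  mul_mem' := by
    intro M N hM hN
    change (M : Matrix (Fin m) (Fin m) K)ᴴ * J * (M : Matrix (Fin m) (Fin m) K) = J at hM
    change (N : Matrix (Fin m) (Fin m) K)ᴴ * J * (N : Matrix (Fin m) (Fin m) K) = J at hN
    change ((M : Matrix (Fin m) (Fin m) K) * (N : Matrix (Fin m) (Fin m) K))ᴴ * J *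
      ((M : Matrix (Fin m) (Fin m) K) * (N : Matrix (Fin m) (Fin m) K)) = J
    calc _ = (N : Matrix (Fin m) (Fin m) K)ᴴ *
          ((M : Matrix (Fin m) (Fin m) K)ᴴ * J * (M : Matrix (Fin m) (Fin m) K)) *
            (N : Matrix (Fin m) (Fin m) K) := by simp only [conjTranspose_mul, Matrix.mul_assoc]
      _ = J := by rw [hM, hN]
  inv_mem' := by
    intro M hM
    change (M : Matrix (Fin m) (Fin m) K)ᴴ * J * (M : Matrix (Fin m) (Fin m) K) = J at hM
    change ((M⁻¹ : SpecialLinearGroup (Fin m) K) : Matrix (Fin m) (Fin m) K)ᴴ * J *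
      ((M⁻¹ : SpecialLinearGroup (Fin m) K) : Matrix (Fin m) (Fin m) K) = J
    have h : (M : Matrix (Fin m) (Fin m) K) * ((M⁻¹ : SpecialLinearGroup (Fin m) K) :
        Matrix (Fin m) (Fin m) K) = 1 :=
      congrArg Subtype.val (mul_inv_cancel M)
    have h' : ((M⁻¹ : SpecialLinearGroup (Fin m) K) : Matrix (Fin m) (Fin m) K)ᴴ *
        (M : Matrix (Fin m) (Fin m) K)ᴴ = 1 := by
      rw [← conjTranspose_mul, h, conjTranspose_one]
    generalize ((M⁻¹ : SpecialLinearGroup (Fin m) K) : Matrix (Fin m) (Fin m) K) = N at *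
    calc Nᴴ * J * N = Nᴴ * ((M : Matrix (Fin m) (Fin m) K)ᴴ * J *
          (M : Matrix (Fin m) (Fin m) K)) * N := by rw [hM]
      _ = (Nᴴ * (M : Matrix (Fin m) (Fin m) K)ᴴ) * J *
          ((M : Matrix (Fin m) (Fin m) K) * N) := by simp only [Matrix.mul_assoc]
      _ = J := by rw [h, h', Matrix.one_mul, Matrix.mul_one]

end Unitary

/-! ### The fields -/

/-- The field `ℚ(t, √(t² - 1))`, with `t` transcendental, as `ℚ(t) ⊕ ℚ(t) √(t² - 1)`. Its `star`
is the involution `τ` over `ℚ(t)` with `√(t² - 1) ↦ -√(t² - 1)`. -/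
abbrev FunField : Type := QuadraticAlgebra (RatFunc ℚ) (RatFunc.X ^ 2 - 1) 0

/-- The field `F = ℚ(√d) = ℚ ⊕ ℚ √d` (for `d` not a square). Its `star` is the involution `τ` with
`√d ↦ -√d`. -/
abbrev QuadField (d : ℕ) : Type := QuadraticAlgebra ℚ (d : ℚ) 0

/-- The integral special unitary group `SU(J; 𝒪_d, τ)`, as a subgroup of `SL(m, F)`; here `𝒪_d`
is the ring of integers of `F = ℚ(√d)`. -/
def SUInt (d : ℕ) {m : ℕ} (J : Matrix (Fin m) (Fin m) (QuadField d)) :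
    Subgroup (SpecialLinearGroup (Fin m) (QuadField d)) :=
  SU J ⊓ (SpecialLinearGroup.map
    (algebraMap (integralClosure ℤ (QuadField d)) (QuadField d))).range

/-- The real embedding `F → ℝ` with `√d ↦ √d > 0`. -/
noncomputable def realEmb (d : ℕ) : QuadField d →+* ℝ :=
  (QuadraticAlgebra.lift (R := ℚ) (a := (d : ℚ)) (b := 0)
    ⟨√(d : ℝ), by simp [Algebra.smul_def]⟩ : QuadField d →ₐ[ℚ] ℝ)

/-- `SU(J; 𝒪_d, τ)` as a subgroup of `SL(m, ℝ)`. -/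
noncomputable def SUIntReal (d : ℕ) {m : ℕ} (J : Matrix (Fin m) (Fin m) (QuadField d)) :
    Subgroup (SpecialLinearGroup (Fin m) ℝ) :=
  (SUInt d J).map (SpecialLinearGroup.map (realEmb d))

/-- Subgroups of `SL(m, ℝ)` are commensurable if, for some `g ∈ SL(m, ℝ)`, the intersection
`Γ₁ ∩ g Γ₂ g⁻¹` has finite index both in `Γ₁` and in `g Γ₂ g⁻¹`. -/
def CommensurableInSL {m : ℕ} (Γ₁ Γ₂ : Subgroup (SpecialLinearGroup (Fin m) ℝ)) : Prop :=
  ∃ g : SpecialLinearGroup (Fin m) ℝ,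
    Subgroup.Commensurable Γ₁ (Γ₂.map (MulAut.conj g).toMonoidHom)

/-! ### Specialization of `t` -/

/-- `x = p + q √(t² - 1)` has no pole at the real number `T`: the denominators of `p` and `q` do
not vanish at `T`. -/
def RegularAt (T : ℝ) (x : FunField) : Prop :=
  Polynomial.aeval T x.re.denom ≠ 0 ∧ Polynomial.aeval T x.im.denom ≠ 0

/-- The value of `x = p + q √(t² - 1)` at the real number `t = T ≥ 1`. -/
noncomputable def evalReal (T : ℝ) (x : FunField) : ℝ :=
  x.re.eval (algebraMap ℚ ℝ) T + x.im.eval (algebraMap ℚ ℝ) T * √(T ^ 2 - 1)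

/-- The value of `x = p + q √(t² - 1)` in `ℚ(√d)` at `t = T`, `√(t² - 1) = Y √d`, for a solution
`(T, Y)` of Pell's equation `T² - d Y² = 1`. -/
noncomputable def evalPell {d : ℕ} (z : Pell.Solution₁ (d : ℤ)) (x : FunField) : QuadField d :=
  ⟨x.re.eval (RingHom.id ℚ) (z.x : ℚ), x.im.eval (RingHom.id ℚ) (z.x : ℚ) * (z.y : ℚ)⟩

/-- `ω_t` over `ℚ(t, √(t² - 1))`. -/
noncomputable def omegaFun : Vol3 →* SpecialLinearGroup (Fin 8) FunField :=
  omega ⟨RatFunc.X, 0⟩ ⟨0, 1⟩ (by ext <;> simp [pow_two, QuadraticAlgebra.re_one, QuadraticAlgebra.im_one])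

/-- `ω_T` over `ℚ(√d)`, for a solution `(T, Y)` of Pell's equation `T² - d Y² = 1`, where
`√(T² - 1) = Y √d`. -/
def omegaPell {d : ℕ} (z : Pell.Solution₁ (d : ℤ)) :
    Vol3 →* SpecialLinearGroup (Fin 8) (QuadField d) :=
  omega ⟨(z.x : ℚ), 0⟩ ⟨0, (z.y : ℚ)⟩ (by
    have h : (z.x : ℚ) ^ 2 - d * (z.y : ℚ) ^ 2 = 1 := by exact_mod_cast z.prop
    ext
    · simp [QuadraticAlgebra.re_one]
      linear_combination -h
    · simp [QuadraticAlgebra.im_one])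

/-! Put w = t + s and v = t - s, so that w v = 1 and `τ` exchanges w and v. The form `omegaForm` has
entries in ℤ[w, v]. Its invariance under `ω_t(u)` and `ω_t(c)` is a finite check modulo w v = 1, and
it passes to the whole image because a and b are words in u and c. As the entries are polynomial in
t and s, they have no poles, and specialization commutes with forming the matrix.

The vectors e₃, e₄, e₅, e₆ span a Lagrangian subspace. Hence the determinant is a product of two 4 ×
4 determinants, each N³ with N = v² + 1 + w² = 4t² - 1. So it is a square, nonzero for real t ≥ 1
and for integral t.

A Lagrangian makes a nondegenerate Hermitian form hyperbolic, so only the hyperbolicity of I₈ over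
ℚ(√d) is left. Four squares give Q with QᴴQ = d I₄, while r = √d has τ(r) r = -d; thus the vectors
(r x, Q x) form a Lagrangian for I₈. This yields P over ℚ(√d) with PᴴP = J
(`omegaForm_exists_conjTranspose_mul_self`).

Conjugation by P carries SU(J) to SU(I₈), and it keeps a congruence subgroup integral since P and
P⁻¹ have bounded denominators (`relIndex_comap_slConj_ne_zero`). Once det P > 0, rescaling P over ℝ
puts the conjugating matrix in SL(8, ℝ). -/

/-! ### The invariant Hermitian form. -/

section Form

variable {A : Type*} [CommRing A]

/-- The Hermitian form preserved by `ω_t`, with `w = t + √(t² - 1)` and `v = t - √(t² - 1)`. -/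
def omegaForm (w v : A) : Matrix (Fin 8) (Fin 8) A :=
  !![v + w, -(v + w), 1, -1, -w ^ 2, 1 + w ^ 2, -(v + w), v;
     -(v + w), 0, -1, 0, v ^ 2 + 1 + w ^ 2, -(v ^ 2 + 1 + w ^ 2), 0, 0;
     1, -1, v + w, -(v + w), v, w, -1, -w ^ 2;
     -1, 0, -(v + w), 0, 0, 0, 0, v ^ 2 + 1 + w ^ 2;
     -v ^ 2, v ^ 2 + 1 + w ^ 2, w, 0, 0, 0, 0, -(v ^ 2 + 1 + w ^ 2);
     v ^ 2 + 1, -(v ^ 2 + 1 + w ^ 2), v, 0, 0, 0, 0, v ^ 2 + 1 + w ^ 2;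
     -(v + w), 0, -1, 0, 0, 0, 0, 0;
     w, 0, -v ^ 2, v ^ 2 + 1 + w ^ 2, -(v ^ 2 + 1 + w ^ 2), v ^ 2 + 1 + w ^ 2, 0, 0]

theorem omegaForm_map {B : Type*} [CommRing B] (f : A →+* B) (w v : A) :
    (omegaForm w v).map f = omegaForm (f w) (f v) := by
  ext i j
  fin_cases i <;> fin_cases j <;> simp [omegaForm]

theorem omegaForm_conjTranspose [StarRing A] {w v : A} (hw : star w = v) :
    (omegaForm w v)ᴴ = omegaForm w v := by
  have hv : star v = w := by rw [← hw, star_star]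
  ext i j
  fin_cases i <;> fin_cases j <;> simp [omegaForm, hw, hv] <;> ring

set_option maxHeartbeats 2000000 in
theorem omegaU_conjTranspose_mul_omegaForm_mul [StarRing A] {t s w v : A} (ht : t + s = w)
    (hs : t - s = v) (hwv : w * v = 1) (hw : star w = v) :
    (omegaU t s)ᴴ * omegaForm w v * omegaU t s = omegaForm w v := by
  have hv : star v = w := by rw [← hw, star_star]
  have h2 : 2 * t = w + v := by rw [← ht, ← hs]; ring
  -- In terms of w and v every entry becomes an identity modulo w v = 1. Here w = t + s, the
  -- opposite of the naming in `slAct_u`.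
  have hU : omegaU t s =
    !![1, 0, 0, w + v, -(w + v), w + v, 0, 0;
       0, 1, 0, v, -v, v, 1, 0;
       0, 0, 1, -1, 1, -1, 0, 0;
       0, 0, 1, 0, 0, 0, 0, 0;
       0, 0, 1, 0, 0, 1, -v, -w;
       0, 0, 1, -1, 0, 1, -v, -w;
       0, 0, 0, 0, 0, 0, 0, -1;
       0, 0, 0, 0, 0, 0, 1, 0] := by
    rw [omegaU, neg_mul, h2, neg_add_eq_sub, ← neg_sub t s, hs, ← neg_add', ht]
  rw [hU]
  ext i j
  fin_cases i <;> fin_cases j <;>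
    simp [omegaForm, mul_apply, Fin.sum_univ_eight, hw, hv] <;> grind

set_option maxHeartbeats 2000000 in
theorem omegaC_conjTranspose_mul_omegaForm_mul [StarRing A] (w v : A) :
    (omegaC)ᴴ * omegaForm w v * omegaC = omegaForm w v := by
  ext i j
  fin_cases i <;> fin_cases j <;>
    simp [omegaForm, omegaC, mul_apply, Fin.sum_univ_eight] <;> ring

end Form

/-! ### A Lagrangian subspace and the determinant. -/

section Blocks

/-- Right multiplication by the block rotation S, a product of three transvections and so of
determinant 1, makes the matrix block lower triangular. -/
theorem det_fromBlocks_zero₁₁ {m R : Type*} [Fintype m] [DecidableEq m] [CommRing R]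
    (B C D : Matrix m m R) :
    (fromBlocks 0 B C D).det = (-B).det * C.det := by
  have hS : (fromBlocks 0 1 (-1) 0 : Matrix (m ⊕ m) (m ⊕ m) R).det = 1 := by
    have : (fromBlocks 0 1 (-1) 0 : Matrix (m ⊕ m) (m ⊕ m) R) =
        fromBlocks 1 1 0 1 * fromBlocks 1 0 (-1) 1 * fromBlocks 1 1 0 1 := by
      simp [fromBlocks_multiply]
    rw [this, det_mul, det_mul]
    simp
  rw [← mul_one (det _), ← hS, ← det_mul, fromBlocks_multiply, ← det_fromBlocks_zero₁₂ _ (-D)]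
  simp

/-- The reordering of the standard basis which puts a basis of a Lagrangian subspace for
`omegaForm` first. -/
noncomputable def lagrangianEquiv : Fin 4 ⊕ Fin 4 ≃ Fin 8 :=
  Equiv.ofBijective (Sum.elim ![3, 4, 5, 6] ![0, 1, 2, 7]) (by decide)

variable {A : Type*} [CommRing A]

/-- The pairing, under `omegaForm`, of a Lagrangian subspace with a complement. -/
def omegaFormPairing (w v : A) : Matrix (Fin 4) (Fin 4) A :=
  (omegaForm w v).submatrix ![3, 4, 5, 6] ![0, 1, 2, 7]

/-- The lower left block is written without `star`: exchanging w and v transposes the form, over any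
commutative ring. -/
theorem omegaForm_submatrix (w v : A) :
    (omegaForm w v).submatrix lagrangianEquiv lagrangianEquiv =
      fromBlocks 0 (omegaFormPairing w v) (omegaFormPairing v w)ᵀ
        ((omegaForm w v).submatrix ![0, 1, 2, 7] ![0, 1, 2, 7]) := by
  ext (i | i) (j | j)
  · fin_cases i <;> fin_cases j <;> rfl
  · rfl
  · change omegaForm w v (![0, 1, 2, 7] i) (![3, 4, 5, 6] j) =
      omegaForm v w (![3, 4, 5, 6] j) (![0, 1, 2, 7] i)
    fin_cases i <;> fin_cases j <;> simp [omegaForm] <;> ring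
  · rfl

theorem det_omegaFormPairing {w v : A} (h : w * v = 1) :
    (omegaFormPairing w v).det = (v ^ 2 + 1 + w ^ 2) ^ 3 := by
  obtain ⟨N, hN⟩ : ∃ N, v ^ 2 + 1 + w ^ 2 = N := ⟨_, rfl⟩
  have : omegaFormPairing w v =
      !![-1, 0, -(v + w), N; -v ^ 2, N, w, -N; v ^ 2 + 1, -N, v, N; -(v + w), 0, -1, 0] := by
    rw [← hN]
    ext i j
    fin_cases i <;> fin_cases j <;> rfl
  -- The column of index 1 is (0, N, -N, 0), so only two minors survive.
  rw [this, hN, det_succ_column _ 1]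
  simp [Fin.sum_univ_succ, det_fin_three, Fin.succAbove]
  have h1 : (v + w) ^ 2 = N + 1 := by linear_combination 2 * h + hN
  grind

theorem det_omegaForm {w v : A} (h : w * v = 1) :
    (omegaForm w v).det = ((v ^ 2 + 1 + w ^ 2) ^ 3) ^ 2 := by
  rw [← det_submatrix_equiv_self lagrangianEquiv, omegaForm_submatrix, det_fromBlocks_zero₁₁,
    det_transpose, det_neg, det_omegaFormPairing h, det_omegaFormPairing (mul_comm v w ▸ h)]
  simp
  ring

end Blocks

/-! ### Equivalence with the standard form. -/

section Equivalence

/-- A Hermitian form with a Lagrangian subspace is equivalent to the standard form of `K ^ 2n`,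
once there is a scalar `r` with `τ r = -r` and a similitude `Q` of `K ^ n` of multiplier `r ^ 2`. -/
theorem exists_conjTranspose_mul_self_eq_fromBlocks {K n : Type*} [CommRing K] [StarRing K]
    [Fintype n] [DecidableEq n] {r : K} (hr : star r = -r) (hru : IsUnit r)
    (h2 : IsUnit (2 : K)) {Q : Matrix n n K} (hQ : Qᴴ * Q = (r * r) • (1 : Matrix n n K))
    {B C : Matrix n n K} (hB : IsUnit B.det) (hC : Cᴴ = C) :
    ∃ P : Matrix (n ⊕ n) (n ⊕ n) K, Pᴴ * P = fromBlocks 0 B Bᴴ C := by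
  obtain ⟨h, hh⟩ := h2.exists_right_inv
  obtain ⟨c, hc⟩ := ((h2.mul hru).mul hru).exists_right_inv
  have hsh : star h = h := by
    have := congrArg star hh
    simp only [star_mul', star_one, star_ofNat] at this
    linear_combination h * this - star h * hh
  have hsc : star c = c := by
    have := congrArg star hc
    simp only [star_mul', star_one, star_ofNat, hr] at this
    linear_combination c * this - star c * hc
  -- The two block columns span isotropic subspaces, because τ(r) r = -r² cancels QᴴQ = r²; they
  -- pair to 2r².
  have hS : (fromBlocks (r • 1) (-r • 1) Q Q)ᴴ * fromBlocks (r • 1) (-r • 1) Q Q =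
      fromBlocks 0 ((2 * r * r) • 1) ((2 * r * r) • 1) (0 : Matrix n n K) := by
    simp only [fromBlocks_conjTranspose, fromBlocks_multiply, hQ, conjTranspose_smul, hr,
      conjTranspose_one, star_neg, neg_neg, smul_mul_smul_comm, Matrix.mul_one, ← add_smul]
    congr 1 <;> ring_nf <;> simp
  have hBu : IsUnit Bᴴ.det := by rw [det_conjTranspose]; exact hB.star
  -- With h = 1/2, the corner produced by the shift Y is YᴴB + BᴴY = C. The factor c = 1/(2r²)
  -- normalizes the pairing to B.
  obtain ⟨Y, hBY⟩ : ∃ Y, Bᴴ * Y = h • C :=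
    ⟨h • ((Bᴴ)⁻¹ * C), by rw [Matrix.mul_smul, mul_nonsing_inv_cancel_left _ _ hBu]⟩
  have hYB : Yᴴ * B = h • C := by
    have := congrArg conjTranspose hBY
    rwa [conjTranspose_mul, conjTranspose_conjTranspose, conjTranspose_smul, hC, hsh] at this
  refine ⟨fromBlocks (r • 1) (-r • 1) Q Q * fromBlocks 1 Y 0 (c • B), ?_⟩
  rw [conjTranspose_mul, Matrix.mul_assoc, ← Matrix.mul_assoc _ _ (fromBlocks 1 Y 0 (c • B)), hS]
  simp only [fromBlocks_conjTranspose, fromBlocks_multiply, conjTranspose_smul, hsc,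
    conjTranspose_one, conjTranspose_zero, smul_mul_assoc, mul_smul_comm, Matrix.mul_one,
    Matrix.one_mul, Matrix.zero_mul, Matrix.mul_zero, smul_zero, add_zero, zero_add, smul_smul, hc,
    hBY, hYB, one_smul]
  rw [mul_comm c, hc]
  congr 1
  · rw [one_smul]
  · rw [← mul_assoc, hc, ← add_smul, one_mul, ← two_mul, hh, one_smul]

/-- Q is left multiplication by a quaternion of norm d with integer coordinates, which Lagrange's
theorem supplies; `star` fixes its entries. -/
theorem exists_conjTranspose_mul_self_eq_natCast_smul_one (K : Type*) [CommRing K] [StarRing K]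
    (d : ℕ) : ∃ Q : Matrix (Fin 4) (Fin 4) K, Qᴴ * Q = (d : K) • (1 : Matrix (Fin 4) (Fin 4) K) := by
  obtain ⟨a, b, c, e, h⟩ := Nat.sum_four_squares d
  have h' : (a : K) ^ 2 + b ^ 2 + c ^ 2 + e ^ 2 = d := by exact_mod_cast congrArg (Nat.cast (R := K)) h
  refine ⟨!![(a : K), -b, -c, -e; b, a, -e, c; c, e, a, -b; e, -c, b, a], ?_⟩
  rw [← h']
  ext i j
  fin_cases i <;> fin_cases j <;> simp [mul_apply, Fin.sum_univ_four] <;> ring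

theorem omegaForm_exists_conjTranspose_mul_self {K : Type*} [CommRing K] [StarRing K] {d : ℕ}
    {r : K} (hr : star r = -r) (hd : r * r = d) (hdu : IsUnit (d : K)) (h2 : IsUnit (2 : K))
    {w v : K} (hw : star w = v) (hwv : w * v = 1) (hN : IsUnit (v ^ 2 + 1 + w ^ 2)) :
    ∃ P : Matrix (Fin 8) (Fin 8) K, Pᴴ * P = omegaForm w v := by
  have hH := congrArg (fun M => M.submatrix lagrangianEquiv lagrangianEquiv)
    (omegaForm_conjTranspose hw)
  simp only [← conjTranspose_submatrix, omegaForm_submatrix, fromBlocks_conjTranspose] at hH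
  obtain ⟨-, h12, -, hC⟩ := fromBlocks_inj.1 hH
  obtain ⟨Q, hQ⟩ := exists_conjTranspose_mul_self_eq_natCast_smul_one K d
  rw [← hd] at hQ
  obtain ⟨P, hP⟩ := exists_conjTranspose_mul_self_eq_fromBlocks hr
    (isUnit_of_mul_isUnit_left (hd ▸ hdu)) h2 hQ (B := omegaFormPairing w v)
    (by rw [det_omegaFormPairing hwv]; exact hN.pow 3) hC
  refine ⟨P.submatrix lagrangianEquiv.symm lagrangianEquiv.symm, ?_⟩
  have h21 : (omegaFormPairing w v)ᴴ = (omegaFormPairing v w)ᵀ := by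
    rw [← h12, conjTranspose_conjTranspose]
  rw [conjTranspose_submatrix, submatrix_mul_equiv, hP, h21, ← omegaForm_submatrix,
    submatrix_submatrix]
  simp

end Equivalence

/-! ### Commensurability of arithmetic groups of equivalent forms. -/

section Commensurability

variable {R : Type*} [CommRing R] {m : ℕ}

/-- Conjugation by an invertible matrix, as an endomorphism of `SL(m, R)`. -/
def slConj (P : (Matrix (Fin m) (Fin m) R)ˣ) :
    SpecialLinearGroup (Fin m) R →* SpecialLinearGroup (Fin m) R where
  toFun M := ⟨P * (M : Matrix (Fin m) (Fin m) R) * (P⁻¹ : (Matrix (Fin m) (Fin m) R)ˣ), by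
    rw [det_units_conj, M.det_coe]⟩
  map_one' := by ext; simp
  map_mul' M N := by
    refine Subtype.ext ?_
    change (P : Matrix (Fin m) (Fin m) R) * (M * N) * (P⁻¹ : (Matrix (Fin m) (Fin m) R)ˣ) =
      P * M * (P⁻¹ : (Matrix (Fin m) (Fin m) R)ˣ) * (P * N * (P⁻¹ : (Matrix (Fin m) (Fin m) R)ˣ))
    simp only [Matrix.mul_assoc]
    rw [P.inv_mul_cancel_left]

theorem slConj_coe (P : (Matrix (Fin m) (Fin m) R)ˣ) (M : SpecialLinearGroup (Fin m) R) :
    (slConj P M : Matrix (Fin m) (Fin m) R) =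
      P * (M : Matrix (Fin m) (Fin m) R) * (P⁻¹ : (Matrix (Fin m) (Fin m) R)ˣ) := rfl

theorem slConj_comp_inv (P : (Matrix (Fin m) (Fin m) R)ˣ) :
    (slConj P).comp (slConj P⁻¹) = MonoidHom.id _ := by
  refine MonoidHom.ext fun M => Subtype.ext ?_
  simp [slConj_coe, ← Matrix.mul_assoc]

theorem slConj_inv_comp (P : (Matrix (Fin m) (Fin m) R)ˣ) :
    (slConj P⁻¹).comp (slConj P) = MonoidHom.id _ := by
  simpa using slConj_comp_inv P⁻¹

theorem comap_slConj (P : (Matrix (Fin m) (Fin m) R)ˣ)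
    (S : Subgroup (SpecialLinearGroup (Fin m) R)) :
    S.comap (slConj P) = S.map (slConj P⁻¹) := by
  ext M
  constructor
  · exact fun h => ⟨_, h, DFunLike.congr_fun (slConj_inv_comp P) M⟩
  · rintro ⟨N, hN, rfl⟩
    have := DFunLike.congr_fun (slConj_comp_inv P) N
    simp only [MonoidHom.comp_apply, MonoidHom.id_apply] at this
    rwa [Subgroup.mem_comap, this]

theorem slConj_mem_SU [StarRing R] {J₁ J₂ : Matrix (Fin m) (Fin m) R}
    {P : (Matrix (Fin m) (Fin m) R)ˣ}
    (h : (P : Matrix (Fin m) (Fin m) R)ᴴ * J₂ * P = J₁) {M : SpecialLinearGroup (Fin m) R}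
    (hM : M ∈ SU J₁) : slConj P M ∈ SU J₂ := by
  change (M : Matrix (Fin m) (Fin m) R)ᴴ * J₁ * (M : Matrix (Fin m) (Fin m) R) = J₁ at hM
  change (slConj P M : Matrix (Fin m) (Fin m) R)ᴴ * J₂ *
    (slConj P M : Matrix (Fin m) (Fin m) R) = J₂
  have h₁ : ((P⁻¹ : (Matrix (Fin m) (Fin m) R)ˣ) : Matrix (Fin m) (Fin m) R)ᴴ *
      (P : Matrix (Fin m) (Fin m) R)ᴴ = 1 := by
    rw [← conjTranspose_mul, P.mul_inv, conjTranspose_one]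
  have h₂ := P.mul_inv
  rw [slConj_coe]
  rw [← h] at hM
  generalize ((P⁻¹ : (Matrix (Fin m) (Fin m) R)ˣ) : Matrix (Fin m) (Fin m) R) = P' at *
  generalize (P : Matrix (Fin m) (Fin m) R) = P at *
  generalize (M : Matrix (Fin m) (Fin m) R) = M at *
  calc (P * M * P')ᴴ * J₂ * (P * M * P')
      = P'ᴴ * (Mᴴ * (Pᴴ * J₂ * P) * M) * P' := by
        simp only [conjTranspose_mul, Matrix.mul_assoc]
    _ = (P'ᴴ * Pᴴ) * J₂ * (P * P') := by rw [hM]; simp only [Matrix.mul_assoc]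
    _ = J₂ := by rw [h₁, h₂, Matrix.one_mul, Matrix.mul_one]

theorem mem_range_map_algebraMap_iff {K : Type*} [CommRing K]
    (M : SpecialLinearGroup (Fin m) K) :
    M ∈ (SpecialLinearGroup.map (n := Fin m) (algebraMap (integralClosure ℤ K) K)).range ↔
      ∀ i j, IsIntegral ℤ (M i j) := by
  constructor
  · rintro ⟨N, rfl⟩ i j
    exact (N i j).2
  · intro h
    let N : Matrix (Fin m) (Fin m) (integralClosure ℤ K) := fun i j => ⟨M i j, h i j⟩
    have hN : N.map (algebraMap (integralClosure ℤ K) K) = M := rfl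
    have hdet : N.det = 1 := by
      have hinj : Function.Injective (algebraMap (integralClosure ℤ K) K) :=
        Subtype.val_injective
      apply hinj
      rw [RingHom.map_det, RingHom.mapMatrix_apply, hN, M.det_coe, map_one]
    exact ⟨⟨N, hdet⟩, Subtype.ext hN⟩

theorem exists_integral_multiple_matrix {K : Type*} [Field K] [NumberField K]
    (P : Matrix (Fin m) (Fin m) K) :
    ∃ N : ℤ, N ≠ 0 ∧ ∀ i j, IsIntegral ℤ ((N : K) * P i j) := by
  have : Algebra.IsAlgebraic ℤ K := (IsFractionRing.comap_isAlgebraic_iff (K := ℚ)).2 inferInstance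
  classical
  obtain ⟨N, hN, h⟩ := Algebra.IsAlgebraic.exists_integral_multiples ℤ
    (Finset.univ.image fun p : Fin m × Fin m => P p.1 p.2)
  refine ⟨N, hN, fun i j => ?_⟩
  rw [← zsmul_eq_mul]
  exact h _ (Finset.mem_image_of_mem _ (Finset.mem_univ (i, j)))

/-- The congruence subgroups have finite index. -/
theorem exists_congruence_subgroup {K : Type*} [Field K] [NumberField K] {N : ℤ} (hN : N ≠ 0) :
    ∃ C : Subgroup (SpecialLinearGroup (Fin m) K),
      C.relIndex (SpecialLinearGroup.map (n := Fin m)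
        (algebraMap (integralClosure ℤ K) K)).range ≠ 0 ∧
      ∀ M ∈ C, ∃ M' : Matrix (Fin m) (Fin m) K, (∀ i j, IsIntegral ℤ (M' i j)) ∧
        (M : Matrix (Fin m) (Fin m) K) = 1 + (N : K) • M' := by
  let I : Ideal (integralClosure ℤ K) := Ideal.span {(N : integralClosure ℤ K)}
  have hI : I ≠ ⊥ := by
    rw [Ne, Ideal.span_singleton_eq_bot]
    intro h
    apply hN
    have := congrArg (algebraMap (integralClosure ℤ K) K) h
    simpa using this
  have : Finite (integralClosure ℤ K ⧸ I) :=
    Ring.HasFiniteQuotients.finiteQuotient (R := NumberField.RingOfIntegers K) hI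
  let q := SpecialLinearGroup.map (n := Fin m) (Ideal.Quotient.mk I)
  have : Finite (SpecialLinearGroup (Fin m) (integralClosure ℤ K ⧸ I)) :=
    Subtype.finite
  refine ⟨q.ker.map (SpecialLinearGroup.map (algebraMap (integralClosure ℤ K) K)), ?_, ?_⟩
  -- C is the image of the kernel of reduction modulo N; that kernel has finite index because SL
  -- over the finite quotient ring is finite.
  · rw [MonoidHom.range_eq_map, Subgroup.relIndex_map_map]
    refine fun h => ?_
    rw [top_sup_eq, Subgroup.relIndex_top_right] at h
    have h' : q.ker.index ≠ 0 := by
      rw [Subgroup.index_ker]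
      exact Nat.card_pos.ne'
    exact h' (Nat.eq_zero_of_zero_dvd (h ▸ Subgroup.index_dvd_of_le le_sup_left))
  · rintro _ ⟨M, hM, rfl⟩
    have hM' : ∀ i j, ∃ x : integralClosure ℤ K, M i j - (1 : Matrix (Fin m) (Fin m) _) i j = N * x := by
      intro i j
      have h1 : Ideal.Quotient.mk I (M i j) =
          Ideal.Quotient.mk I ((1 : Matrix (Fin m) (Fin m) _) i j) := by
        have := congrArg (fun A : SpecialLinearGroup (Fin m) (integralClosure ℤ K ⧸ I) => A i j)
          (MonoidHom.mem_ker.1 hM)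
        simp only [q, SpecialLinearGroup.map_apply_coe, RingHom.mapMatrix_apply, map_apply] at this
        rw [this]
        by_cases h : i = j <;> simp [Matrix.one_apply, h]
      exact Ideal.mem_span_singleton'.1 (Ideal.Quotient.eq.1 h1) |>.imp fun x hx => by
        rw [← hx, mul_comm]
    choose x hx using hM'
    refine ⟨fun i j => x i j, fun i j => (x i j).2, ?_⟩
    ext i j
    have := congrArg (algebraMap (integralClosure ℤ K) K) (hx i j)
    rw [map_sub, map_mul, map_intCast] at this
    rw [sub_eq_iff_eq_add'] at this
    refine Eq.trans this (congrArg (· + _) ?_)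
    by_cases h : i = j <;> simp [Matrix.one_apply, h]

/-- If N₁P and N₂P⁻¹ are integral and M = 1 + N₁N₂M' with M' integral, then PMP⁻¹ = 1 +
(N₁P)M'(N₂P⁻¹) is integral. Such M contain a subgroup of finite index. -/
theorem relIndex_comap_slConj_ne_zero {d : ℕ} [Fact (∀ r : ℚ, r ^ 2 ≠ (d : ℚ) + 0 * r)]
    [NumberField (QuadField d)] {J₁ J₂ : Matrix (Fin m) (Fin m) (QuadField d)}
    {P : (Matrix (Fin m) (Fin m) (QuadField d))ˣ}
    (h : (P : Matrix (Fin m) (Fin m) (QuadField d))ᴴ * J₂ *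
      (P : Matrix (Fin m) (Fin m) (QuadField d)) = J₁) :
    ((SUInt d J₂).comap (slConj P)).relIndex (SUInt d J₁) ≠ 0 := by
  obtain ⟨N₁, hN₁, h₁⟩ := exists_integral_multiple_matrix
    (P : Matrix (Fin m) (Fin m) (QuadField d))
  obtain ⟨N₂, hN₂, h₂⟩ := exists_integral_multiple_matrix
    ((P⁻¹ : (Matrix (Fin m) (Fin m) (QuadField d))ˣ) : Matrix (Fin m) (Fin m) (QuadField d))
  obtain ⟨C, hC, hCM⟩ := exists_congruence_subgroup (m := m) (K := QuadField d)
    (mul_ne_zero hN₁ hN₂)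
  have hC' : (C ⊓ SUInt d J₁).relIndex (SUInt d J₁) ≠ 0 := by
    rw [Subgroup.inf_relIndex_right]
    exact fun h0 => hC (Subgroup.relIndex_eq_zero_of_le_right inf_le_right h0)
  refine fun h0 => hC' (Subgroup.relIndex_eq_zero_of_le_left ?_ h0)
  rintro M ⟨hMC, hM⟩
  refine ⟨slConj_mem_SU h hM.1, (mem_range_map_algebraMap_iff _).2 fun i j => ?_⟩
  obtain ⟨M', hM', hM1⟩ := hCM M hMC
  have key : (slConj P M : Matrix (Fin m) (Fin m) (QuadField d)) =
      1 + ((N₁ : QuadField d) • (P : Matrix (Fin m) (Fin m) (QuadField d))) * M' *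
        ((N₂ : QuadField d) • ((P⁻¹ : (Matrix (Fin m) (Fin m) (QuadField d))ˣ) :
          Matrix (Fin m) (Fin m) (QuadField d))) := by
    rw [slConj_coe, hM1, Matrix.mul_add, Matrix.add_mul, Matrix.mul_one, P.mul_inv]
    simp only [smul_mul_assoc, mul_smul_comm, smul_smul, Int.cast_mul, mul_comm]
  rw [key, Matrix.add_apply, mul_apply]
  refine IsIntegral.add ?_ (IsIntegral.sum _ fun k _ => IsIntegral.mul ?_ (h₂ k j))
  · rw [one_apply]
    split_ifs
    exacts [isIntegral_one, isIntegral_zero]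
  · rw [mul_apply]
    exact IsIntegral.sum _ fun l _ => (h₁ i l).mul (hM' l k)

theorem commensurable_comap_slConj {d : ℕ} [Fact (∀ r : ℚ, r ^ 2 ≠ (d : ℚ) + 0 * r)]
    [NumberField (QuadField d)] {J₁ J₂ : Matrix (Fin m) (Fin m) (QuadField d)}
    {P : (Matrix (Fin m) (Fin m) (QuadField d))ˣ}
    (h : (P : Matrix (Fin m) (Fin m) (QuadField d))ᴴ * J₂ *
      (P : Matrix (Fin m) (Fin m) (QuadField d)) = J₁) :
    Subgroup.Commensurable (SUInt d J₁) ((SUInt d J₂).comap (slConj P)) := by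
  have h' : ((P⁻¹ : (Matrix (Fin m) (Fin m) (QuadField d))ˣ) :
      Matrix (Fin m) (Fin m) (QuadField d))ᴴ * J₁ *
      ((P⁻¹ : (Matrix (Fin m) (Fin m) (QuadField d))ˣ) :
        Matrix (Fin m) (Fin m) (QuadField d)) = J₂ := by
    rw [← h, ← Matrix.mul_assoc, ← Matrix.mul_assoc, ← conjTranspose_mul, P.mul_inv,
      Matrix.mul_assoc, P.mul_inv, conjTranspose_one, Matrix.one_mul, Matrix.mul_one]
  -- The other index is the same estimate for P⁻¹, pulled back along conjugation by P.
  have h2 := Subgroup.relIndex_comap_ne_zero (slConj P) (relIndex_comap_slConj_ne_zero h')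
  rw [Subgroup.comap_comap, slConj_inv_comp, Subgroup.comap_id] at h2
  exact ⟨h2, relIndex_comap_slConj_ne_zero h⟩

/-- Scaling Q by the positive m-th root of 1 / det Q gives determinant 1 and does not change the
conjugation. -/
theorem exists_conj_eq_slConj (hm : m ≠ 0) {Q : (Matrix (Fin m) (Fin m) ℝ)ˣ}
    (hQ : 0 < (Q : Matrix (Fin m) (Fin m) ℝ).det) :
    ∃ g : SpecialLinearGroup (Fin m) ℝ, (MulAut.conj g).toMonoidHom = slConj Q := by
  obtain ⟨c, hc⟩ : ∃ c : ℝ, c ^ m * (Q : Matrix (Fin m) (Fin m) ℝ).det = 1 := by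
    refine ⟨((Q : Matrix (Fin m) (Fin m) ℝ).det⁻¹) ^ (m⁻¹ : ℝ), ?_⟩
    rw [Real.rpow_inv_natCast_pow (inv_nonneg.2 hQ.le) hm, inv_mul_cancel₀ hQ.ne']
  obtain ⟨g, hg⟩ : ∃ g : SpecialLinearGroup (Fin m) ℝ,
      (g : Matrix (Fin m) (Fin m) ℝ) = c • (Q : Matrix (Fin m) (Fin m) ℝ) :=
    ⟨⟨c • (Q : Matrix (Fin m) (Fin m) ℝ), by rw [det_smul, Fintype.card_fin, hc]⟩, rfl⟩
  refine ⟨g, MonoidHom.ext fun M => ?_⟩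
  change g * M * g⁻¹ = slConj Q M
  rw [mul_inv_eq_iff_eq_mul]
  refine Subtype.ext ?_
  simp [slConj_coe, Matrix.mul_assoc, hg]

theorem commensurableInSL_of_conjTranspose_mul_self {d : ℕ}
    [Fact (∀ r : ℚ, r ^ 2 ≠ (d : ℚ) + 0 * r)] [NumberField (QuadField d)] (hm : m ≠ 0)
    {J₁ J₂ : Matrix (Fin m) (Fin m) (QuadField d)} {P : Matrix (Fin m) (Fin m) (QuadField d)}
    (h : Pᴴ * J₂ * P = J₁) (hP : 0 < realEmb d P.det) :
    CommensurableInSL (SUIntReal d J₁) (SUIntReal d J₂) := by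
  have hu : IsUnit P := by
    rw [isUnit_iff_isUnit_det, isUnit_iff_ne_zero]
    rintro h0
    simp [h0] at hP
  obtain ⟨P, rfl⟩ := hu
  let Q : (Matrix (Fin m) (Fin m) ℝ)ˣ := Units.map (realEmb d).mapMatrix.toMonoidHom P
  have hQ : (Q : Matrix (Fin m) (Fin m) ℝ).det = realEmb d
      (P : Matrix (Fin m) (Fin m) (QuadField d)).det := ((realEmb d).map_det _).symm
  have hQi : 0 < ((Q⁻¹ : (Matrix (Fin m) (Fin m) ℝ)ˣ) : Matrix (Fin m) (Fin m) ℝ).det := by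
    have := congrArg det Q.mul_inv
    rw [det_mul, hQ, det_one] at this
    exact pos_of_mul_pos_right (this ▸ one_pos) hP.le
  -- The inverse is needed: conjugation by P goes from SU(J₁) to SU(J₂), whereas g has to move the
  -- second group towards the first.
  obtain ⟨g, hg⟩ := exists_conj_eq_slConj hm hQi
  refine ⟨g, ?_⟩
  have hcomp : (slConj Q⁻¹).comp (SpecialLinearGroup.map (realEmb d)) =
      (SpecialLinearGroup.map (realEmb d)).comp (slConj P⁻¹) := by
    refine MonoidHom.ext fun M => Subtype.ext ?_
    exact (((realEmb d).mapMatrix.map_mul _ _).trans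
      (congrArg (· * _) ((realEmb d).mapMatrix.map_mul _ _))).symm
  have hinj : Function.Injective
      (SpecialLinearGroup.map (n := Fin m) (realEmb d)) := by
    intro M N hMN
    refine Subtype.ext (Matrix.ext fun i j => (realEmb d).injective ?_)
    exact congrArg (fun A : SpecialLinearGroup (Fin m) ℝ => A i j) hMN
  have hc := commensurable_comap_slConj h
  rw [hg, SUIntReal, SUIntReal, Subgroup.map_map, hcomp, ← Subgroup.map_map, ← comap_slConj]
  exact ⟨by rw [Subgroup.relIndex_map_map_of_injective _ _ hinj]; exact hc.1,
    by rw [Subgroup.relIndex_map_map_of_injective _ _ hinj]; exact hc.2⟩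

end Commensurability

/-! ### Locating the image of the representation. -/

section Range

variable {A : Type*} [CommRing A]

/-- The matrices of u and c suffice, since the images of a and b are words in them. -/
theorem omega_range_le {t s : A} (h : s * s = t * t - 1)
    {S : Subgroup (SpecialLinearGroup (Fin 8) A)} (hu : omegaUSL t s ∈ S)
    (hc : (omegaCSL : SpecialLinearGroup (Fin 8) A) ∈ S) : (omega t s h).range ≤ S := by
  have ha : omegaGenA t s ∈ S := S.mul_mem (S.pow_mem hu 2) hc
  have hb : omegaGenB t s ∈ S :=
    S.mul_mem (S.inv_mem (S.mul_mem (S.mul_mem ha hu) ha)) hu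
  rw [MonoidHom.range_eq_map, ← PresentedGroup.closure_range_of, MonoidHom.map_closure,
    Subgroup.closure_le]
  rintro _ ⟨_, ⟨i, rfl⟩, rfl⟩
  rw [omega, PresentedGroup.toGroup.of]
  fin_cases i
  exacts [ha, hb]

theorem omega_range_le_SU [StarRing A] {t s w v : A} (h : s * s = t * t - 1)
    (hw : t + s = w) (hv : t - s = v) (hwv : star w = v) :
    (omega t s h).range ≤ SU (omegaForm w v) :=
  omega_range_le h
    (omegaU_conjTranspose_mul_omegaForm_mul hw hv
      (by rw [← hw, ← hv]; linear_combination -h) hwv)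
    (omegaC_conjTranspose_mul_omegaForm_mul _ _)

theorem omega_range_le_range_map {B : Type*} [CommRing B] (f : B →+* A) {t s : A}
    (h : s * s = t * t - 1) (ht : t ∈ f.range) (hs : s ∈ f.range) :
    (omega t s h).range ≤ (SpecialLinearGroup.map (n := Fin 8) f).range := by
  obtain ⟨t, rfl⟩ := ht
  obtain ⟨s, rfl⟩ := hs
  refine omega_range_le h ⟨omegaUSL t s, Subtype.ext ?_⟩ ⟨omegaCSL, Subtype.ext ?_⟩
  · change (omegaU t s).map f = omegaU (f t) (f s)
    ext i j
    fin_cases i <;> fin_cases j <;> simp [omegaU, map_ofNat f 2]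
  · change omegaC.map f = omegaC
    ext i j
    fin_cases i <;> fin_cases j <;> simp [omegaC]

end Range

/-! ### Specialization of the parameter. -/

section Specialization

/-- The ring `ℚ[t, √(t² - 1)]`. -/
abbrev PolyRing : Type := QuadraticAlgebra ℚ[X] (Polynomial.X ^ 2 - 1) 0

/-- The ring homomorphism on `ℚ[t, √(t² - 1)]` which extends `f` and maps `√(t² - 1)` to `s`. -/
noncomputable def PolyRing.lift {A : Type*} [CommRing A] (f : ℚ[X] →+* A) (s : A)
    (h : s * s = f (Polynomial.X ^ 2 - 1)) : PolyRing →+* A where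
  toFun p := f p.re + f p.im * s
  map_one' := by simp [QuadraticAlgebra.re_one, QuadraticAlgebra.im_one]
  map_zero' := by simp
  map_mul' p q := by
    simp only [QuadraticAlgebra.re_mul, QuadraticAlgebra.im_mul, map_add, map_mul, ← h]
    simp
    ring
  map_add' p q := by
    simp only [QuadraticAlgebra.re_add, QuadraticAlgebra.im_add, map_add]
    ring

theorem PolyRing.lift_apply {A : Type*} [CommRing A] (f : ℚ[X] →+* A) (s : A)
    (h : s * s = f (Polynomial.X ^ 2 - 1)) (p : PolyRing) :
    PolyRing.lift f s h p = f p.re + f p.im * s := rfl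

/-- The inclusion of `ℚ[t, √(t² - 1)]` into its field of fractions. -/
noncomputable def PolyRing.toFunField (p : PolyRing) : FunField :=
  ⟨algebraMap ℚ[X] (RatFunc ℚ) p.re, algebraMap ℚ[X] (RatFunc ℚ) p.im⟩

theorem regularAt_toFunField (T : ℝ) (p : PolyRing) : RegularAt T p.toFunField := by
  simp [RegularAt, PolyRing.toFunField]

/-- On polynomial elements evaluation is a ring homomorphism, which is what lets it pass through
`omegaForm`. -/
theorem evalReal_toFunField {T : ℝ} (hT : 1 ≤ T) (p : PolyRing) :
    evalReal T p.toFunField = PolyRing.lift (Polynomial.aeval T : ℚ[X] →ₐ[ℚ] ℝ).toRingHom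
      √(T ^ 2 - 1) (by
        have : 0 ≤ T ^ 2 - 1 := by nlinarith
        simp [Real.mul_self_sqrt this]) p := by
  simp [evalReal, PolyRing.toFunField, PolyRing.lift_apply, RatFunc.eval_algebraMap,
    Polynomial.aeval_def]

theorem evalPell_toFunField {d : ℕ} (z : Pell.Solution₁ (d : ℤ)) (p : PolyRing) :
    evalPell z p.toFunField =
      PolyRing.lift ((algebraMap ℚ (QuadField d)).comp (Polynomial.evalRingHom (z.x : ℚ)))
        ⟨0, z.y⟩ (by
          have h : (z.x : ℚ) ^ 2 - d * (z.y : ℚ) ^ 2 = 1 := by exact_mod_cast z.prop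
          ext
          · simp [pow_two, QuadraticAlgebra.re_one]
            linear_combination -h
          · simp [pow_two, QuadraticAlgebra.im_one]) p := by
  ext <;> simp [evalPell, PolyRing.toFunField, PolyRing.lift_apply, RatFunc.eval_algebraMap]

/-- The invariant form over `ℚ(t, √(t² - 1))`. -/
noncomputable def omegaFormFun : Matrix (Fin 8) (Fin 8) FunField :=
  (omegaForm (⟨Polynomial.X, 1⟩ : PolyRing) ⟨Polynomial.X, -1⟩).map PolyRing.toFunField

theorem omegaFormFun_eq : omegaFormFun = omegaForm (⟨RatFunc.X, 1⟩ : FunField) ⟨RatFunc.X, -1⟩ := by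
  have h : PolyRing.toFunField = PolyRing.lift
      ((algebraMap (RatFunc ℚ) FunField).comp (algebraMap ℚ[X] (RatFunc ℚ))) ⟨0, 1⟩
      (by ext <;> simp [pow_two, QuadraticAlgebra.re_one, QuadraticAlgebra.im_one]) := by
    funext p
    ext <;> simp [PolyRing.toFunField, PolyRing.lift_apply]
  rw [omegaFormFun, h, omegaForm_map]
  congr 1 <;> ext <;> simp [PolyRing.lift_apply]

theorem omegaFormFun_map_evalReal {T : ℝ} (hT : 1 ≤ T) :
    omegaFormFun.map (evalReal T) = omegaForm (T + √(T ^ 2 - 1)) (T - √(T ^ 2 - 1)) := by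
  rw [omegaFormFun, Matrix.map_map, show evalReal T ∘ PolyRing.toFunField = _ from
    funext (evalReal_toFunField hT), omegaForm_map]
  congr 1
  · simp [PolyRing.lift_apply]
  · simp [PolyRing.lift_apply]
    ring

theorem omegaFormFun_map_evalPell {d : ℕ} (z : Pell.Solution₁ (d : ℤ)) :
    omegaFormFun.map (evalPell z) =
      omegaForm (⟨z.x, z.y⟩ : QuadField d) ⟨z.x, -z.y⟩ := by
  rw [omegaFormFun, Matrix.map_map, show evalPell z ∘ PolyRing.toFunField = _ from
    funext (evalPell_toFunField z), omegaForm_map]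
  congr 1 <;> ext <;> simp [PolyRing.lift_apply]

end Specialization

/-! ### Pell solutions and the arithmetic groups over ℚ(√d). -/

section Pell

theorem not_isSquare_of_squarefree {d : ℕ} (hd : Squarefree d) (h2 : 2 ≤ d) : ¬IsSquare d := by
  rintro ⟨r, rfl⟩
  have := Nat.isUnit_iff.1 (hd r dvd_rfl)
  simp [this] at h2

theorem rat_sq_ne_of_not_isSquare {d : ℕ} (hd : ¬IsSquare d) (r : ℚ) :
    r ^ 2 ≠ (d : ℚ) + 0 * r := by
  intro h
  exact hd (Rat.isSquare_natCast_iff.1 ⟨r, by linear_combination -h⟩)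

theorem Pell.IsFundamental.tendsto_pow_x {d : ℤ} {u : Pell.Solution₁ d}
    (hu : Pell.IsFundamental u) : Tendsto (fun n : ℕ => (u ^ n).x) atTop atTop := by
  refine tendsto_atTop_mono (f := fun n : ℕ => (n : ℤ)) (fun n => ?_) tendsto_natCast_atTop_atTop
  -- Carrying y ≥ 0 through the induction gives x_{n+1} ≥ x_n x_1 ≥ 2 x_n.
  have : ∀ n : ℕ, (n : ℤ) + 1 ≤ (u ^ n).x ∧ 0 ≤ (u ^ n).y := by
    intro n
    induction n with
    | zero => simp
    | succ n ih =>
      have h1 := hu.1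
      have h2 := hu.2.1
      have h3 := hu.d_pos
      rw [pow_succ, Pell.Solution₁.x_mul, Pell.Solution₁.y_mul]
      have h4 : 0 ≤ d * ((u ^ n).y * u.y) := by
        have := ih.2
        positivity
      push_cast
      refine ⟨by nlinarith, ?_⟩
      have h5 : 0 ≤ (u ^ n).x := by linarith [ih.1]
      have := ih.2
      positivity
  linarith [(this n).1]

variable {d : ℕ}

theorem numberField_quadField [Fact (∀ r : ℚ, r ^ 2 ≠ (d : ℚ) + 0 * r)] :
    NumberField (QuadField d) where
  to_charZero := inferInstance
  to_finiteDimensional := by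
    have : Module.Finite ℚ (QuadField d) := inferInstance
    convert this

theorem isIntegral_intCast_add_intCast_mul_sqrt (a b : ℤ) :
    IsIntegral ℤ (⟨a, b⟩ : QuadField d) := by
  have hr : IsIntegral ℤ (⟨0, 1⟩ : QuadField d) := by
    refine IsIntegral.of_pow two_pos ?_
    have : (⟨0, 1⟩ : QuadField d) ^ 2 = algebraMap ℤ (QuadField d) d := by
      ext <;> simp [pow_two]
    rw [this]
    exact isIntegral_algebraMap
  have : (⟨a, b⟩ : QuadField d) = algebraMap ℤ (QuadField d) a +
      algebraMap ℤ (QuadField d) b * ⟨0, 1⟩ := by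
    ext <;> simp
  rw [this]
  exact isIntegral_algebraMap.add (isIntegral_algebraMap.mul hr)

theorem omegaPell_range_le (z : Pell.Solution₁ (d : ℤ)) :
    (omegaPell z).range ≤ SUInt d (omegaFormFun.map (evalPell z)) := by
  refine le_inf ?_ ?_
  · rw [omegaFormFun_map_evalPell]
    exact omega_range_le_SU _ (by ext <;> simp) (by ext <;> simp) (by ext <;> simp)
  · refine omega_range_le_range_map _ _ ?_ ?_
    · exact ⟨⟨_, by simpa [mem_integralClosure_iff] using
        isIntegral_intCast_add_intCast_mul_sqrt z.x 0⟩, rfl⟩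
    · exact ⟨⟨_, by simpa [mem_integralClosure_iff] using
        isIntegral_intCast_add_intCast_mul_sqrt 0 z.y⟩, rfl⟩

theorem exists_conjTranspose_mul_self_det_pos [Fact (∀ r : ℚ, r ^ 2 ≠ (d : ℚ) + 0 * r)]
    {J : Matrix (Fin 8) (Fin 8) (QuadField d)} (hJ : J.det ≠ 0)
    (h : ∃ P : Matrix (Fin 8) (Fin 8) (QuadField d), Pᴴ * P = J) :
    ∃ P : Matrix (Fin 8) (Fin 8) (QuadField d), Pᴴ * P = J ∧ 0 < realEmb d P.det := by
  obtain ⟨P, hP⟩ := h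
  have h0 : realEmb d P.det ≠ 0 := by
    rw [Ne, map_eq_zero]
    intro h0
    apply hJ
    rw [← hP, det_mul, h0, mul_zero]
  rcases h0.lt_or_gt with h0 | h0
  -- A reflection preserving I₈ flips the sign of det P without changing PᴴP.
  · let D : Fin 8 → QuadField d := ![-1, 1, 1, 1, 1, 1, 1, 1]
    have hD : (diagonal D)ᴴ * diagonal D = 1 := by
      rw [diagonal_conjTranspose, diagonal_mul_diagonal, ← diagonal_one]
      congr 1
      funext i
      fin_cases i <;> simp [D]
    refine ⟨diagonal D * P, ?_, ?_⟩
    · rw [conjTranspose_mul, Matrix.mul_assoc, ← Matrix.mul_assoc _ _ P, hD, Matrix.one_mul, hP]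
    · rw [det_mul, det_diagonal]
      simpa [D, Fin.prod_univ_eight] using h0
  · exact ⟨P, hP, h0⟩

theorem commensurableInSL_omegaForm [Fact (∀ r : ℚ, r ^ 2 ≠ (d : ℚ) + 0 * r)] (hd : d ≠ 0)
    (z : Pell.Solution₁ (d : ℤ)) :
    CommensurableInSL (SUIntReal d (omegaFormFun.map (evalPell z)))
      (SUIntReal d (1 : Matrix (Fin 8) (Fin 8) (QuadField d))) := by
  have := numberField_quadField (d := d)
  have hz : (z.x : ℚ) ^ 2 - d * (z.y : ℚ) ^ 2 = 1 := by exact_mod_cast z.prop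
  have hwv : (⟨z.x, z.y⟩ : QuadField d) * ⟨z.x, -z.y⟩ = 1 := by
    ext
    · simp [QuadraticAlgebra.re_one]
      linear_combination hz
    · simp [QuadraticAlgebra.im_one]
      ring
  -- By Pell's equation this element equals 4x² - 1, which is nonzero for an integer x by parity.
  have hN : (⟨z.x, -z.y⟩ : QuadField d) ^ 2 + 1 + ⟨z.x, z.y⟩ ^ 2 ≠ 0 := by
    intro h
    have h' := congrArg QuadraticAlgebra.re h
    simp [pow_two, QuadraticAlgebra.re_one] at h'
    have : (4 : ℚ) * (z.x : ℚ) ^ 2 = 1 := by linear_combination h' + 2 * hz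
    have : (4 : ℤ) * z.x ^ 2 = 1 := by exact_mod_cast this
    omega
  rw [omegaFormFun_map_evalPell]
  obtain ⟨P, hP, hpos⟩ := exists_conjTranspose_mul_self_det_pos
    (J := omegaForm (⟨z.x, z.y⟩ : QuadField d) ⟨z.x, -z.y⟩)
    (by rw [det_omegaForm hwv]; exact pow_ne_zero _ (pow_ne_zero _ hN))
    (omegaForm_exists_conjTranspose_mul_self (d := d) (r := ⟨0, 1⟩) (by ext <;> simp)
      (by ext <;> simp) (Nat.cast_ne_zero.2 hd).isUnit two_ne_zero.isUnit (by ext <;> simp)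
      hwv hN.isUnit)
  exact commensurableInSL_of_conjTranspose_mul_self (by norm_num) (by rwa [Matrix.mul_one]) hpos

end Pell

theorem lemma1 :
    ∃ J : Matrix (Fin 8) (Fin 8) FunField,
      -- `J` is `τ`-Hermitian over `ℚ(t, √(t² - 1))`
      Jᴴ = J ∧
      -- for real `T ≥ 1` the form `J_T` is defined and has full rank
      (∀ T : ℝ, 1 ≤ T →
        (∀ i j, RegularAt T (J i j)) ∧ (J.map (evalReal T)).det ≠ 0) ∧
      -- the determinant is a square in `ℚ(t)`
      (∃ q : RatFunc ℚ, J.det = algebraMap (RatFunc ℚ) FunField (q ^ 2)) ∧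
      -- `ω_t(vol3) < SU(J_t; ℚ(t, √(t² - 1)), τ)`
      omegaFun.range ≤ SU J ∧
      -- the Pell solutions `t_n + y_n √d = u ^ n`, `u` the fundamental solution
      ∀ d : ℕ, Squarefree d → 2 ≤ d →
        ∃ u : Pell.Solution₁ (d : ℤ), Pell.IsFundamental u ∧
          Tendsto (fun n : ℕ => (u ^ n).x) atTop atTop ∧
          ∀ n : ℕ, 1 ≤ n →
            (omegaPell (u ^ n)).range ≤ SUInt d (J.map (evalPell (u ^ n))) ∧
            CommensurableInSL (SUIntReal d (J.map (evalPell (u ^ n))))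
              (SUIntReal d (1 : Matrix (Fin 8) (Fin 8) (QuadField d))) := by
  refine ⟨omegaFormFun, ?_, fun T hT => ⟨fun i j => regularAt_toFunField T _, ?_⟩,
    -- The square root of the determinant is N³, with N = v² + 1 + w² = 4t² - 1.
    ⟨(4 * RatFunc.X ^ 2 - 1) ^ 3, ?_⟩, ?_, fun d hd h2 => ?_⟩
  · rw [omegaFormFun_eq]
    exact omegaForm_conjTranspose (by ext <;> simp)
  · have hs : √(T ^ 2 - 1) ^ 2 = T ^ 2 - 1 := Real.sq_sqrt (by nlinarith)
    rw [omegaFormFun_map_evalReal hT, det_omegaForm (by linear_combination -hs)]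
    refine pow_ne_zero _ (pow_ne_zero _ (ne_of_gt ?_))
    positivity
  · rw [omegaFormFun_eq, det_omegaForm (by
      ext <;> simp [QuadraticAlgebra.re_one, QuadraticAlgebra.im_one] <;> ring), map_pow, map_pow]
    congr 2
    ext
    · simp [pow_two, QuadraticAlgebra.re_one]
      ring
    · simp [pow_two, QuadraticAlgebra.im_one]
  · rw [omegaFormFun_eq]
    exact omega_range_le_SU _ (by ext <;> simp) (by ext <;> simp) (by ext <;> simp)
  · have hsq := not_isSquare_of_squarefree hd h2
    have : Fact (∀ r : ℚ, r ^ 2 ≠ (d : ℚ) + 0 * r) := ⟨rat_sq_ne_of_not_isSquare hsq⟩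
    obtain ⟨u, hu⟩ := Pell.IsFundamental.exists_of_not_isSquare (d := (d : ℤ)) (by omega)
      (by rwa [Int.isSquare_natCast_iff])
    exact ⟨u, hu, hu.tendsto_pow_x, fun n _ =>
      ⟨omegaPell_range_le _, commensurableInSL_omegaForm (by omega) _⟩⟩
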